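/- For integers $k,m\ge 1$ let $\mathrm{M}(k,m)=\frac1m\sum_{d\mid m}\mu\left(\frac md\right)k^d$ be the (integer-valued) necklace polynomial, $\mu$ being the Möbius function. A cyclic array of shape $(M,N)$, $M,N\ge1$, with entries in a finite alphabet of size $K$ (its rows are indexed modulo $M$, its columns modulo $N$) is called an $(M,N;\,m,n)_K$-sub-perfect map, $m,n\ge1$, if every pattern of shape $(m,n)$ over the alphabet (i.e. every $m\times n$ array of letters) occurs at most once in it, as a block of $m$ cyclically consecutive rows and $n$ cyclically consecutive columns. A sequence $(A_i)_{i\in\mathbb N}$ of sub-perfect maps over an alphabet of size $K$, $A_i$ of type $(M_i,N_i;\,m_i,n_i)_K$, is increasing if $m_i<m_j$ and $n_i<n_j$ whenever $i<j$. A set $\mathcal M$ of sub-perfect maps over an alphabet of size $K>2$ is a family of almost perfect maps if for all $m',n'\ge1$ it contains a map of some type $(M,N;\,m,n)_K$ with $m>m'$ and $n>n'$, and if $\lim_{i\to\infty}\frac{M_iN_i}{K^{m_in_i}}=1$ for every increasing sequence $(A_i)_{i\in\mathbb N}$ of elements of $\mathcal M$, $A_i$ being of type $(M_i,N_i;\,m_i,n_i)_K$.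 Corollary. Let $k\ge2$ and fix an alphabet with $k^2$ letters. For $n\ge 2$ put $$n'=\mathrm{M}(k^n,n)\bmod n\qquad\text{and}\qquad N(n)=n\cdot\bigl(\mathrm{M}(k^n,n)-|n'-1|\cdot[n'<n-1]\bigr),$$ where $[\,\cdot\,]$ is the Iverson bracket ($1$ if the condition holds, $0$ otherwise). Then for every $n\ge2$ there exists an $(N,N;\,n,n)_{k^2}$-sub-perfect map over this alphabet with $N=N(n)$, and $$N(n)\;\ge\; n\cdot\bigl(\mathrm{M}(k^n,n)-\max(1,n-3)\bigr)\;>\;k^{n^2}-k^{(\lfloor n/2\rfloor+1)n}-\max(n,n^2-3n).$$ Moreover, the set of all $(N(n),N(n);\,n,n)_{k^2}$-sub-perfect maps over this alphabet, with $n$ ranging over the integers $\ge2$, is a family of almost perfect maps. -/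

import Mathlib

/-- The sum `∑_{d ∣ m} μ(m / d) k ^ d`. -/
def necklaceSum (k m : ℕ) : ℤ :=
  ∑ d ∈ m.divisors, ArithmeticFunction.moebius (m / d) * (k : ℤ) ^ d

lemma prime_pow_dvd_pow_sub (k p a e : ℕ) (hp : p.Prime) :
    ((p : ℤ) ^ (a + 1)) ∣ (k : ℤ) ^ (p ^ (a + 1) * e) - (k : ℤ) ^ (p ^ a * e) := by
  have hp' : Fact p.Prime := ⟨hp⟩
  have h : (p : ℤ) ∣ ((k : ℤ) ^ e) ^ p - (k : ℤ) ^ e := by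
    rw [← ZMod.intCast_zmod_eq_zero_iff_dvd]
    push_cast
    rw [ZMod.pow_card, sub_self]
  have h2 := dvd_sub_pow_of_dvd_sub h a
  have e1 : (k : ℤ) ^ (p ^ (a + 1) * e) = (((k : ℤ) ^ e) ^ p) ^ p ^ a := by
    rw [← pow_mul, ← pow_mul]; congr 1; ring
  have e2 : (k : ℤ) ^ (p ^ a * e) = ((k : ℤ) ^ e) ^ p ^ a := by
    rw [← pow_mul]; congr 1; ring
  rw [e1, e2]
  exact h2

lemma prime_pow_dvd_necklaceSum (k p b q : ℕ) (hp : p.Prime) (hq : ¬ p ∣ q) :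
    (p : ℤ) ^ (b + 1) ∣ necklaceSum k (p ^ (b + 1) * q) := by
  have hq0 : 0 < q := Nat.pos_of_ne_zero (by rintro rfl; simp at hq)
  have hp0 := hp.pos
  have hm : p ^ (b + 1) * q ≠ 0 := by positivity
  have hS : necklaceSum k (p ^ (b + 1) * q) = ∑ x ∈ (p ^ (b + 1) * q).divisors,
      ArithmeticFunction.moebius x * (k : ℤ) ^ (p ^ (b + 1) * q / x) := by
    rw [necklaceSum, ← Nat.sum_div_divisors]
    refine Finset.sum_congr rfl fun d hd => ?_
    rw [Nat.div_div_self (Nat.dvd_of_mem_divisors hd) hm]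
  have hinj : Set.InjOn (fun y => p * y) (q.divisors : Set ℕ) :=
    fun x _ y _ h => Nat.eq_of_mul_eq_mul_left hp0 h
  have hdisj : Disjoint q.divisors (q.divisors.image fun y => p * y) := by
    rw [Finset.disjoint_left]
    intro x hx hx'
    obtain ⟨y, _, rfl⟩ := Finset.mem_image.1 hx'
    exact hq ((Dvd.intro y rfl).trans (Nat.dvd_of_mem_divisors hx))
  have hsub : q.divisors ∪ (q.divisors.image fun y => p * y) ⊆ (p ^ (b + 1) * q).divisors := by
    intro x hx
    rw [Nat.mem_divisors]
    refine ⟨?_, hm⟩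
    rcases Finset.mem_union.1 hx with h | h
    · exact (Nat.dvd_of_mem_divisors h).mul_left _
    · obtain ⟨y, hy, rfl⟩ := Finset.mem_image.1 h
      exact mul_dvd_mul (dvd_pow_self p (by omega)) (Nat.dvd_of_mem_divisors hy)
  rw [hS, ← Finset.sum_subset hsub, Finset.sum_union hdisj, Finset.sum_image hinj,
    ← Finset.sum_add_distrib]
  · refine Finset.dvd_sum fun y hy => ?_
    have hyq := Nat.dvd_of_mem_divisors hy
    obtain ⟨e, rfl⟩ := hyq
    have hy0 : 0 < y := Nat.pos_of_ne_zero (by rintro rfl; simp at hq0)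
    have hpy : p.Coprime y :=
      (Nat.Prime.coprime_iff_not_dvd hp).2 fun h => hq (h.mul_right e)
    have e1 : p ^ (b + 1) * (y * e) / y = p ^ (b + 1) * e :=
      Nat.div_eq_of_eq_mul_left hy0 (by ring)
    have e2 : p ^ (b + 1) * (y * e) / (p * y) = p ^ b * e :=
      Nat.div_eq_of_eq_mul_left (by positivity) (by ring)
    rw [e1, e2, ArithmeticFunction.isMultiplicative_moebius.map_mul_of_coprime hpy,
      ArithmeticFunction.moebius_apply_prime hp]
    have h := (prime_pow_dvd_pow_sub k p b e hp).mul_left (ArithmeticFunction.moebius y)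
    convert h using 1
    ring
  · intro x hx hx'
    have hxd := Nat.dvd_of_mem_divisors hx
    have : ¬ Squarefree x := by
      intro hsq
      apply hx'
      rw [Finset.mem_union, Finset.mem_image]
      by_cases hpx : p ∣ x
      · right
        obtain ⟨y, rfl⟩ := hpx
        have hpy : ¬ p ∣ y := by
          rintro ⟨z, rfl⟩
          exact hp.one_lt.ne' (Nat.isUnit_iff.1 (hsq p ⟨z, by ring⟩))
        refine ⟨y, Nat.mem_divisors.2 ⟨?_, hq0.ne'⟩, rfl⟩
        exact Nat.Coprime.dvd_of_dvd_mul_left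
          (((Nat.Prime.coprime_iff_not_dvd hp).2 hpy).symm.pow_right _)
          ((Dvd.intro_left p rfl).trans hxd)
      · left
        exact Nat.mem_divisors.2 ⟨Nat.Coprime.dvd_of_dvd_mul_left
          (((Nat.Prime.coprime_iff_not_dvd hp).2 hpx).symm.pow_right _) hxd, hq0.ne'⟩
    rw [ArithmeticFunction.moebius_eq_zero_of_not_squarefree this, zero_mul]

lemma dvd_necklaceSum (k m : ℕ) : (m : ℤ) ∣ necklaceSum k m := by
  rcases Nat.eq_zero_or_pos m with rfl | hm
  · simp [necklaceSum]
  rw [Int.natCast_dvd, Nat.dvd_iff_prime_pow_dvd_dvd]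
  intro p a hp ha
  rcases a with _ | a
  · simp
  obtain ⟨b, q, hq, rfl⟩ := Nat.exists_eq_pow_mul_and_not_dvd hm.ne' p hp.ne_one
  have hab : p ^ (a + 1) ∣ p ^ b :=
    Nat.Coprime.dvd_of_dvd_mul_right
      (((Nat.Prime.coprime_iff_not_dvd hp).2 hq).pow_left _) ha
  rcases b with _ | b
  · rw [pow_zero, Nat.dvd_one] at hab
    exact absurd hab (Nat.one_lt_pow (by omega) hp.one_lt).ne'
  refine hab.trans ?_
  rw [← Int.natCast_dvd]
  exact_mod_cast prime_pow_dvd_necklaceSum k p b q hp hq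

/-- The necklace polynomial `M(k, m) = (1 / m) ∑_{d ∣ m} μ(m / d) k ^ d`. The integer division is
exact, see `mul_necklace`. -/
def necklace (k m : ℕ) : ℤ :=
  necklaceSum k m / m

lemma mul_necklace (k m : ℕ) :
    (m : ℤ) * necklace k m =
      ∑ d ∈ m.divisors, ArithmeticFunction.moebius (m / d) * (k : ℤ) ^ d :=
  Int.mul_ediv_cancel' (dvd_necklaceSum k m)

/-- A cyclic array `A` of shape `(M, N)` (rows and columns are indexed modulo `M` and modulo `N`)
shows the pattern `P` of shape `(m, n)` at position `(x, y)`. -/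
def OccursAt {T : Type*} {M N m n : ℕ} (A : ZMod M → ZMod N → T) (P : Fin m → Fin n → T)
    (x : ZMod M) (y : ZMod N) : Prop :=
  ∀ (i : Fin m) (j : Fin n), A (x + (i : ℕ)) (y + (j : ℕ)) = P i j

/-- The cyclic array `A` of shape `(M, N)` over the alphabet `T` is an `(M, N; m, n)`-sub-perfect
map: every pattern of shape `(m, n)` occurs at most once. -/
def IsSubPerfectMap {T : Type*} {M N : ℕ} (A : ZMod M → ZMod N → T) (m n : ℕ) : Prop :=
  0 < M ∧ 0 < N ∧ 0 < m ∧ 0 < n ∧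
    ∀ P : Fin m → Fin n → T,
      {z : ZMod M × ZMod N | OccursAt A P z.1 z.2}.Subsingleton

/-- A sub-perfect map over the alphabet `T`, together with its type `(M, N; m, n)`. -/
structure SubPerfectMap (T : Type*) where
  M : ℕ
  N : ℕ
  m : ℕ
  n : ℕ
  entry : ZMod M → ZMod N → T
  isSubPerfectMap : IsSubPerfectMap entry m n

/-- Increasing sequences of sub-perfect maps: both side lengths of the patterns strictly
increase. -/
def IsIncreasingSeq {T : Type*} (A : ℕ → SubPerfectMap T) : Prop :=
  ∀ i j : ℕ, i < j → (A i).m < (A j).m ∧ (A i).n < (A j).n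

/-- Families of almost perfect maps over an alphabet with more than two letters. -/
def IsAlmostPerfectFamily {T : Type*} [Fintype T] (F : Set (SubPerfectMap T)) : Prop :=
  2 < Fintype.card T ∧
  (∀ m' n' : ℕ, 1 ≤ m' → 1 ≤ n' → ∃ A ∈ F, m' < A.m ∧ n' < A.n) ∧
  ∀ A : ℕ → SubPerfectMap T, (∀ i, A i ∈ F) → IsIncreasingSeq A →
    Filter.Tendsto
      (fun i => (((A i).M : ℝ) * ((A i).N : ℝ)) /
        (Fintype.card T : ℝ) ^ ((A i).m * (A i).n))
      Filter.atTop (nhds 1)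

/-- The residue `n' = M(k ^ n, n) mod n`. -/
def residue (k n : ℕ) : ℤ :=
  necklace (k ^ n) n % n

/-- The side length `n * (M(k ^ n, n) - |n' - 1| * [n' < n - 1])` with
`n' = M(k ^ n, n) mod n`. -/
def squareSide (k n : ℕ) : ℤ :=
  n * (necklace (k ^ n) n - |residue k n - 1| * (if residue k n < (n : ℤ) - 1 then 1 else 0))

/-- The set of the sub-perfect maps over `T` of type `(N, N; n, n)` with `2 ≤ n` and
`N = squareSide k n`. -/
def squareMaps (k : ℕ) (T : Type*) : Set (SubPerfectMap T) :=
  {A | 2 ≤ A.n ∧ A.m = A.n ∧ (A.M : ℤ) = squareSide k A.n ∧ (A.N : ℤ) = squareSide k A.n}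

/-! With `n` cyclic rows, a window of full height and width `n` is a cyclic word of length `n` whose
letters are rows in `K ^ n`. Up to row shifts, the aperiodic windows are counted by M(k^n, n). They
are the edges of a de Bruijn-like graph: the source and target of a window are the necklaces of its
first and last `n - 1` columns. Cyclically permuting columns shows that the graph is balanced, and a
walk through an aperiodic column connects it, so it has an Eulerian circuit. Read column by column,
the circuit is an `n × M` array whose windows determine their position: the class gives the column,
aperiodicity the row (`exists_array_of_loops`).

Windows with all columns equal are loops of the graph. Deleting `δ` of them keeps it Eulerian and
lowers `M` by `δ`; the formula for N(n) picks `δ` so that `M` becomes ±1 modulo `n`. The array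
superposed with its transpose, over pairs of letters, then fixes both coordinates modulo `n` and
modulo `M`, hence modulo `n * M` (`isSubPerfectMap_superpose`). The term `d = n` dominates the
necklace sum, which gives the bounds and the limit. -/

/-- In a directed graph with edge set `E`, suppose every edge can be followed by another one in a
bijective way, and that every edge can be reached from `e₀`. Then the graph has an Eulerian
circuit. -/
theorem exists_eulerian_perm {E V : Type*} [Finite E] (src tgt : E → V) (σ₀ : Equiv.Perm E)
    (hσ₀ : ∀ e, src (σ₀ e) = tgt e) (e₀ : E)
    (hconn : ∀ S : Set E, e₀ ∈ S → (∀ e ∈ S, ∀ f, src f = tgt e → f ∈ S) → ∀ f, f ∈ S) :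
    ∃ σ : Equiv.Perm E, (∀ e, src (σ e) = tgt e) ∧ ∀ f, σ.SameCycle e₀ f := by
  classical
  obtain ⟨σ, hσ, hmax⟩ := Set.exists_max_image {σ : Equiv.Perm E | ∀ e, src (σ e) = tgt e}
    (fun σ => {f | σ.SameCycle e₀ f}.ncard) (Set.toFinite _) ⟨σ₀, hσ₀⟩
  refine ⟨σ, hσ, hconn {f | σ.SameCycle e₀ f} (Equiv.Perm.SameCycle.refl _ _) ?_⟩
  intro e he f hf
  -- If an edge `f` leaving the end of `e` lies off the cycle of `e₀`, exchanging the successors of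
  -- `e` and of the predecessor `f'` of `f` merges two cycles, against maximality.
  by_contra hnf
  simp only [Set.mem_ofPred_eq] at he hnf
  set f' := σ.symm f with hf'
  have hσf' : σ f' = f := by simp [hf']
  have hnf' : ¬ σ.SameCycle e₀ f' := by
    rwa [hf', Equiv.Perm.sameCycle_symm_apply_right]
  set τ := σ * Equiv.swap e f' with hτ
  have hτe : τ e = f := by simp [hτ, hσf']
  have hτf' : τ f' = σ e := by simp [hτ]
  have hτo : ∀ x, x ≠ e → x ≠ f' → τ x = σ x := fun x h1 h2 => by
    simp [hτ, Equiv.swap_apply_of_ne_of_ne h1 h2]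
  have hτmem : ∀ e, src (τ e) = tgt e := by
    intro x
    by_cases h1 : x = e
    · rw [h1, hτe, hf]
    by_cases h2 : x = f'
    · rw [h2, hτf', hσ, ← hf, ← hσf', hσ]
    · rw [hτo x h1 h2, hσ]
  -- The old cycle, entered at `σ e`, avoids `f'`, so `τ` follows it all the way round to `e`.
  have hcyc : ∀ x, σ.SameCycle e₀ x → τ.SameCycle (σ e) x := by
    intro x hx
    have h : σ.SameCycle (σ e) x := by
      rw [Equiv.Perm.sameCycle_apply_left]; exact he.symm.trans hx
    obtain ⟨i, rfl⟩ := h.exists_nat_pow_eq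
    clear h hx
    induction i with
    | zero => exact Equiv.Perm.SameCycle.refl _ _
    | succ i ih =>
      rw [pow_succ', Equiv.Perm.mul_apply]
      set y := (σ ^ i) (σ e) with hy
      by_cases h1 : y = e
      · rw [h1]
      · have h2 : y ≠ f' := by
          intro h
          apply hnf'
          rw [← h, hy, Equiv.Perm.sameCycle_pow_right, Equiv.Perm.sameCycle_apply_right]
          exact he
        rw [← hτo y h1 h2, Equiv.Perm.sameCycle_apply_right]
        exact ih
  have h1 : {x | σ.SameCycle e₀ x} ⊂ {x | τ.SameCycle e₀ x} := by
    rw [Set.ssubset_iff_of_subset]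
    · refine ⟨f, ?_, hnf⟩
      have := (hcyc e₀ (Equiv.Perm.SameCycle.refl _ _)).symm.trans (hcyc e he)
      rw [← Equiv.Perm.sameCycle_apply_right, hτe] at this
      exact this
    · exact fun x hx => (hcyc e₀ (Equiv.Perm.SameCycle.refl _ _)).symm.trans (hcyc x hx)
  exact absurd (hmax τ hτmem) (not_le.2 (Set.ncard_lt_ncard h1 (Set.toFinite _)))

/-! ### Cyclic words, necklaces and their number -/

section Rotation

open scoped Finset

variable {n : ℕ} {L L' : Type*}

/-- The cyclic shift by `r` of a cyclic word of length `n`. -/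
def rotate (r : ZMod n) (f : ZMod n → L) : ZMod n → L := fun x => f (x + r)

lemma rotate_apply (r : ZMod n) (f : ZMod n → L) (x : ZMod n) : rotate r f x = f (x + r) := rfl

lemma rotate_zero (f : ZMod n → L) : rotate 0 f = f := by
  funext x; simp [rotate]

lemma rotate_rotate (r s : ZMod n) (f : ZMod n → L) :
    rotate r (rotate s f) = rotate (r + s) f := by
  funext x; simp [rotate, add_assoc]

lemma rotate_comp (r : ZMod n) (g : L → L') (f : ZMod n → L) :
    rotate r (g ∘ f) = g ∘ rotate r f := rfl

/-- A cyclic word is primitive if no nontrivial shift fixes it. -/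
def IsPrimitive (f : ZMod n → L) : Prop := ∀ r : ZMod n, rotate r f = f → r = 0

lemma IsPrimitive.rotate {f : ZMod n → L} (hf : IsPrimitive f) (s : ZMod n) :
    IsPrimitive (rotate s f) := by
  intro r h
  apply hf
  have := congrArg (_root_.rotate (-s)) h
  simpa [rotate_rotate, rotate_zero, add_comm, add_left_comm] using this

lemma IsPrimitive.of_comp {f : ZMod n → L} {g : L → L'} (hf : IsPrimitive (g ∘ f)) :
    IsPrimitive f := by
  intro r h
  apply hf
  rw [rotate_comp, h]

lemma IsPrimitive.comp {f : ZMod n → L} {g : L → L'} (hf : IsPrimitive f)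
    (hg : Function.Injective g) : IsPrimitive (g ∘ f) := by
  intro r h
  apply hf
  rw [rotate_comp] at h
  funext x
  exact hg (congrFun h x)

lemma IsPrimitive.rotate_injective {f : ZMod n → L} (hf : IsPrimitive f) {r s : ZMod n}
    (h : _root_.rotate r f = _root_.rotate s f) : r = s := by
  have := congrArg (_root_.rotate (-s)) h
  simp only [rotate_rotate, neg_add_cancel, rotate_zero] at this
  have := hf _ this
  rwa [neg_add_eq_zero, eq_comm] at this

lemma rotate_one_iterate (d : ℕ) (f : ZMod n → L) :
    (rotate (1 : ZMod n))^[d] f = rotate (d : ZMod n) f := by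
  induction d with
  | zero => simp [rotate_zero]
  | succ d ih =>
    rw [Function.iterate_succ_apply', ih, rotate_rotate]
    congr 1
    push_cast
    ring

lemma isPeriodicPt_rotate_iff (d : ℕ) (f : ZMod n → L) :
    Function.IsPeriodicPt (rotate (1 : ZMod n)) d f ↔ rotate (d : ZMod n) f = f := by
  rw [Function.IsPeriodicPt, Function.IsFixedPt, rotate_one_iterate]

lemma minimalPeriod_rotate_dvd (f : ZMod n → L) :
    Function.minimalPeriod (rotate (1 : ZMod n)) f ∣ n := by
  rw [← Function.isPeriodicPt_iff_minimalPeriod_dvd, isPeriodicPt_rotate_iff, ZMod.natCast_self,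
    rotate_zero]

/-- Since 1 generates `ZMod n`, all shifts are iterates of `rotate 1`, and primitivity becomes a
statement about its orbits. -/
lemma isPrimitive_iff_minimalPeriod [NeZero n] (f : ZMod n → L) :
    IsPrimitive f ↔ Function.minimalPeriod (rotate (1 : ZMod n)) f = n := by
  constructor
  · intro h
    refine Nat.dvd_antisymm (minimalPeriod_rotate_dvd f) ?_
    rw [← ZMod.natCast_eq_zero_iff]
    apply h
    rw [← isPeriodicPt_rotate_iff]
    exact Function.isPeriodicPt_minimalPeriod _ _
  · intro h r hr
    have h1 : rotate ((r.val : ℕ) : ZMod n) f = f := by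
      rw [ZMod.natCast_zmod_val, hr]
    rw [← isPeriodicPt_rotate_iff, Function.isPeriodicPt_iff_minimalPeriod_dvd, h,
      ← ZMod.natCast_eq_zero_iff, ZMod.natCast_zmod_val] at h1
    exact h1

lemma rotate_mul_eq {f : ZMod n → L} {d : ZMod n} (h : rotate d f = f) (q : ℕ) :
    rotate (d * (q : ZMod n)) f = f := by
  induction q with
  | zero => simp [rotate_zero]
  | succ q ih => rw [Nat.cast_succ, mul_add, mul_one, ← rotate_rotate, h, ih]

/-- Words of period `d` are exactly the pullbacks of words on `ZMod d`. -/
lemma card_periodic [NeZero n] [Fintype L] [DecidableEq L] {d : ℕ} (hd : d ∣ n) :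
    #{f : ZMod n → L | rotate (d : ZMod n) f = f} = Fintype.card L ^ d := by
  have hd0 : NeZero d := ⟨fun h => NeZero.ne n (by rw [h] at hd; exact Nat.eq_zero_of_zero_dvd hd)⟩
  have hinj : Function.Injective
      (fun (g : ZMod d → L) (x : ZMod n) => g (ZMod.castHom hd (ZMod d) x)) := by
    intro g g' h
    funext y
    obtain ⟨x, rfl⟩ := ZMod.castHom_surjective hd y
    exact congrFun h x
  have himg : ({f : ZMod n → L | rotate (d : ZMod n) f = f} : Finset _) =
      Finset.univ.image
        (fun (g : ZMod d → L) (x : ZMod n) => g (ZMod.castHom hd (ZMod d) x)) := by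
    ext f
    simp only [Finset.mem_filter, Finset.mem_univ, true_and, Finset.mem_image]
    constructor
    · intro h
      refine ⟨fun y => f (y.val : ZMod n), ?_⟩
      funext x
      have h1 : (ZMod.castHom hd (ZMod d) x).val = x.val % d := by
        conv_lhs => rw [← ZMod.natCast_zmod_val x]
        rw [map_natCast, ZMod.val_natCast]
      have h2 := congrFun (rotate_mul_eq h (x.val / d)) ((x.val % d : ℕ) : ZMod n)
      rw [rotate_apply] at h2
      simp only [h1]
      rw [← h2]
      congr 1
      conv_rhs => rw [← ZMod.natCast_zmod_val x, ← Nat.mod_add_div x.val d]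
      push_cast
      ring
    · rintro ⟨g, rfl⟩
      funext x
      simp only [rotate_apply, map_add, map_natCast, CharP.cast_eq_zero, add_zero]
  rw [himg, Finset.card_image_of_injective _ hinj, Finset.card_univ, Fintype.card_fun, ZMod.card]

/-- Möbius inversion over the divisors of `n`: words fixed by the shift by `d` split according to
their minimal period. -/
lemma card_isPrimitive [NeZero n] [Fintype L] :
    (Nat.card {f : ZMod n → L // IsPrimitive f} : ℤ) = necklaceSum (Fintype.card L) n := by
  classical
  have hn : 0 < n := NeZero.pos n
  let P : ℕ → ℤ := fun d =>
    #{f : ZMod n → L | Function.minimalPeriod (rotate (1 : ZMod n)) f = d}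
  have key := (ArithmeticFunction.sum_eq_iff_sum_mul_moebius_eq_on (R := ℤ) (f := P)
    (g := fun d => (Fintype.card L : ℤ) ^ d) {d | d ∣ n}
    (fun a b hab hb => hab.trans hb)).1 ?_ n hn dvd_rfl
  · have h1 : (Nat.card {f : ZMod n → L // IsPrimitive f} : ℤ) = P n := by
      simp only [P, isPrimitive_iff_minimalPeriod]
      rw [Nat.card_eq_fintype_card, Fintype.card_subtype]
    rw [h1, ← key, necklaceSum]
    exact Nat.sum_divisorsAntidiagonal' (fun a b =>
      ((ArithmeticFunction.moebius a : ℤ) : ℤ) * (Fintype.card L : ℤ) ^ b)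
  · intro d hd hdn
    have hdn' : d ∣ n := hdn
    have h2 := card_periodic (L := L) hdn'
    simp only [P]
    rw [← Nat.cast_sum, ← Nat.cast_pow, ← h2]
    congr 1
    rw [← Finset.card_biUnion]
    · congr 1
      ext f
      simp [← isPeriodicPt_rotate_iff, Function.isPeriodicPt_iff_minimalPeriod_dvd, hd.ne']
    · intro a _ b _ hab
      rw [Function.onFun, Finset.disjoint_left]
      intro f hf hf'
      simp only [Finset.mem_filter, Finset.mem_univ, true_and] at hf hf'
      exact hab (hf.symm.trans hf')

variable (n L) in
/-- Cyclic words up to shifts. -/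
def rotateSetoid : Setoid (ZMod n → L) where
  r f g := ∃ r, rotate r f = g
  iseqv :=
    { refl := fun f => ⟨0, rotate_zero f⟩
      symm := by
        rintro f _ ⟨r, rfl⟩
        exact ⟨-r, by rw [rotate_rotate, neg_add_cancel, rotate_zero]⟩
      trans := by
        rintro f _ _ ⟨r, rfl⟩ ⟨s, rfl⟩
        exact ⟨s + r, by rw [rotate_rotate]⟩ }

variable (n L) in
/-- The set of necklaces: cyclic words up to shifts. -/
def Necklace : Type _ := Quotient (rotateSetoid n L)

/-- The necklace of a cyclic word. -/
def toNecklace (f : ZMod n → L) : Necklace n L := Quotient.mk (rotateSetoid n L) f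

lemma toNecklace_surjective : Function.Surjective (toNecklace : (ZMod n → L) → Necklace n L) :=
  Quotient.exists_rep

lemma toNecklace_eq_iff {f g : ZMod n → L} :
    toNecklace f = toNecklace g ↔ ∃ r, rotate r f = g :=
  Quotient.eq (r := rotateSetoid n L)

/-- Aperiodic necklaces. -/
def Necklace.IsPrimitive (q : Necklace n L) : Prop :=
  ∃ f : ZMod n → L, _root_.IsPrimitive f ∧ toNecklace f = q

lemma isPrimitive_toNecklace {f : ZMod n → L} :
    (toNecklace f).IsPrimitive ↔ IsPrimitive f := by
  constructor
  · rintro ⟨g, hg, h⟩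
    obtain ⟨r, rfl⟩ := toNecklace_eq_iff.1 h
    exact hg.rotate r
  · exact fun h => ⟨f, h, rfl⟩

/-- The action of a map of letters on necklaces. -/
def Necklace.map (g : L → L') : Necklace n L → Necklace n L' :=
  Quotient.map (g ∘ ·) (by rintro f _ ⟨r, rfl⟩; exact ⟨r, rfl⟩)

lemma map_toNecklace (g : L → L') (f : ZMod n → L) :
    (toNecklace f).map g = toNecklace (g ∘ f) := rfl

instance [NeZero n] [Finite L] : Finite (Necklace n L) :=
  Finite.of_surjective _ toNecklace_surjective

/-- An aperiodic necklace has exactly `n` representatives, one for each shift. -/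
lemma card_primitive_necklace [NeZero n] [Fintype L] :
    (Nat.card {q : Necklace n L // q.IsPrimitive} : ℤ) = necklace (Fintype.card L) n := by
  have hn : (n : ℤ) ≠ 0 := by exact_mod_cast NeZero.ne n
  have h : Nat.card {f : ZMod n → L // IsPrimitive f} =
      Nat.card {q : Necklace n L // q.IsPrimitive} * n := by
    have : Nat.card ({q : Necklace n L // q.IsPrimitive} × ZMod n) =
        Nat.card {q : Necklace n L // q.IsPrimitive} * n := by
      rw [Nat.card_prod, Nat.card_zmod]
    rw [← this]
    symm
    choose rep hrep hrep' using fun q : {q : Necklace n L // q.IsPrimitive} => q.2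
    refine Nat.card_congr (Equiv.ofBijective
      (fun p => ⟨rotate p.2 (rep p.1), (hrep p.1).rotate p.2⟩) ⟨?_, ?_⟩)
    · rintro ⟨q, r⟩ ⟨q', r'⟩ h
      simp only [Subtype.mk.injEq] at h
      have hq : q = q' := by
        apply Subtype.ext
        rw [← hrep' q, ← hrep' q', toNecklace_eq_iff]
        refine ⟨-r' + r, ?_⟩
        rw [← rotate_rotate, h, rotate_rotate, neg_add_cancel, rotate_zero]
      subst hq
      rw [(hrep q).rotate_injective h]
    · rintro ⟨f, hf⟩
      have := hrep' ⟨toNecklace f, f, hf, rfl⟩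
      obtain ⟨r, hr⟩ := toNecklace_eq_iff.1 this
      exact ⟨(⟨toNecklace f, f, hf, rfl⟩, r), Subtype.ext hr⟩
  have h2 := card_isPrimitive (n := n) (L := L)
  rw [h] at h2
  apply mul_left_cancel₀ hn
  rw [mul_necklace]
  push_cast at h2
  rw [mul_comm, h2, necklaceSum]

end Rotation

/-! ### The Eulerian circuit of aperiodic windows -/

section Circuit

open scoped Finset

variable {n m : ℕ} {K : Type*}

/-- Every word over `Fin m → K` can be reached from the constant one, by moving windows which are
primitive since they contain the primitive column `e`. -/
lemma mem_of_closed_under_primitive_windows {e : ZMod n → K} (he : IsPrimitive e) (a : K)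
    (U : Set (ZMod n → Fin m → K)) (h0 : (fun _ _ => a) ∈ U)
    (hU : ∀ w : ZMod n → Fin (m + 1) → K, IsPrimitive w →
      (fun x => w x ∘ Fin.castSucc) ∈ U → (fun x => w x ∘ Fin.succ) ∈ U)
    (u : ZMod n → Fin m → K) : u ∈ U := by
  -- The columns run through `m` copies of `a`, then `m` copies of `e`, then `u`.
  let z : ZMod n → ℕ → K := fun x t =>
    if t < m then a else if t < 2 * m then e x else
      if h : t - 2 * m < m then u x ⟨t - 2 * m, h⟩ else a
  have key : ∀ i ≤ 2 * m, (fun x (j : Fin m) => z x (i + j)) ∈ U := by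
    intro i
    induction i with
    | zero =>
      intro _
      convert h0 using 3 with x j
      simp [z]
    | succ i ih =>
      intro hi
      have hprim : IsPrimitive (fun x (j : Fin (m + 1)) => z x (i + j)) := by
        -- Truncated subtraction selects column `max m i` of `z`, which is a copy of `e` because `i
        -- < 2 * m`.
        let j₀ : Fin (m + 1) := ⟨m - i, by omega⟩
        refine IsPrimitive.of_comp (g := fun v => v j₀) ?_
        convert he using 1
        funext x
        have h1 : ¬ i + (m - i) < m := by omega
        have h2 : i + (m - i) < 2 * m := by omega
        simp [z, j₀, h1, h2]
      have := hU _ hprim (ih (by omega))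
      convert this using 3 with x j
      simp only [Function.comp_apply, Fin.val_succ]
      congr 1
      ring
  have := key (2 * m) le_rfl
  convert this using 3 with x j
  have h1 : ¬ 2 * m + (j : ℕ) < m := by omega
  simp [z, h1]

/-- The windows used by the circuit: aperiodic necklaces, without the loops at the columns in
`D`. -/
abbrev WindowClass (m : ℕ) (D : Set (Necklace n K)) : Type _ :=
  {q : Necklace n (Fin (m + 1) → K) //
    q.IsPrimitive ∧ q ∉ Necklace.map (fun c (_ : Fin (m + 1)) => c) '' D}

lemma card_windowClass [NeZero n] [Fintype K] {D : Set (Necklace n K)}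
    (hD : ∀ q ∈ D, q.IsPrimitive) :
    (Nat.card (WindowClass m D) : ℤ) =
      necklace (Fintype.card K ^ (m + 1)) n - D.ncard := by
  have hinj : Function.Injective
      (Necklace.map (n := n) (fun (c : K) (_ : Fin (m + 1)) => c)) := by
    intro q q' h
    obtain ⟨f, rfl⟩ := toNecklace_surjective q
    obtain ⟨f', rfl⟩ := toNecklace_surjective q'
    exact congrArg (Necklace.map (fun v : Fin (m + 1) → K => v 0)) h
  have hsub : Necklace.map (fun c (_ : Fin (m + 1)) => c) '' D ⊆
      {q : Necklace n (Fin (m + 1) → K) | q.IsPrimitive} := by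
    rintro _ ⟨q, hq, rfl⟩
    obtain ⟨f, hf, rfl⟩ := hD q hq
    exact ⟨_, hf.comp (fun a b h => congrFun h 0), rfl⟩
  have h1 := Set.ncard_sdiff_add_ncard_of_subset hsub
  rw [Set.ncard_image_of_injective _ hinj] at h1
  have h2 : ({q : Necklace n (Fin (m + 1) → K) | q.IsPrimitive}.ncard : ℤ) =
      necklace (Fintype.card K ^ (m + 1)) n := by
    have := card_primitive_necklace (n := n) (L := Fin (m + 1) → K)
    rw [Fintype.card_fun, Fintype.card_fin] at this
    rw [← this]
    rfl
  have h3 : Nat.card (WindowClass m D) = ({q : Necklace n (Fin (m + 1) → K) | q.IsPrimitive} \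
      Necklace.map (fun c (_ : Fin (m + 1)) => c) '' D).ncard := rfl
  rw [h3, ← h2, ← h1]
  simp

/-- The cyclic shift of the columns of a window class, which fixes the loops. -/
def Necklace.shiftColumns : Equiv.Perm (Necklace n (Fin (m + 1) → K)) where
  toFun := Necklace.map (fun v => v ∘ finRotate (m + 1))
  invFun := Necklace.map (fun v => v ∘ (finRotate (m + 1)).symm)
  left_inv q := by
    obtain ⟨f, rfl⟩ := toNecklace_surjective q
    simp only [map_toNecklace]
    congr 1
    funext x j
    simp
  right_inv q := by
    obtain ⟨f, rfl⟩ := toNecklace_surjective q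
    simp only [map_toNecklace]
    congr 1
    funext x j
    simp

lemma shiftColumns_toNecklace (f : ZMod n → Fin (m + 1) → K) :
    Necklace.shiftColumns (toNecklace f) =
      toNecklace ((fun v => v ∘ finRotate (m + 1)) ∘ f) := rfl

lemma shiftColumns_isPrimitive_iff (q : Necklace n (Fin (m + 1) → K)) :
    (Necklace.shiftColumns q).IsPrimitive ↔ q.IsPrimitive := by
  obtain ⟨f, rfl⟩ := toNecklace_surjective q
  rw [shiftColumns_toNecklace, isPrimitive_toNecklace, isPrimitive_toNecklace]
  exact ⟨fun h => h.of_comp, fun h => h.comp (finRotate (m + 1)).surjective.injective_comp_right⟩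

lemma shiftColumns_mem_loops_iff (D : Set (Necklace n K)) (q : Necklace n (Fin (m + 1) → K)) :
    Necklace.shiftColumns q ∈ Necklace.map (fun c (_ : Fin (m + 1)) => c) '' D ↔
      q ∈ Necklace.map (fun c (_ : Fin (m + 1)) => c) '' D := by
  have hfix : ∀ p : Necklace n K,
      Necklace.shiftColumns (p.map (fun c (_ : Fin (m + 1)) => c)) = p.map (fun c _ => c) := by
    intro p
    obtain ⟨f, rfl⟩ := toNecklace_surjective p
    rfl
  constructor
  · rintro ⟨p, hp, h⟩
    rw [← hfix, Necklace.shiftColumns.injective.eq_iff] at h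
    exact ⟨p, hp, h⟩
  · rintro ⟨p, hp, rfl⟩
    exact ⟨p, hp, (hfix p).symm⟩

/-- This makes the column shift a successor bijection on edges, the balance condition of
`exists_eulerian_perm`. -/
lemma shiftColumns_source (q : Necklace n (Fin (m + 1) → K)) :
    (Necklace.shiftColumns q).map (fun v => v ∘ Fin.castSucc) =
      q.map (fun v => v ∘ Fin.succ) := by
  obtain ⟨f, rfl⟩ := toNecklace_surjective q
  rw [shiftColumns_toNecklace, map_toNecklace, map_toNecklace]
  congr 1
  funext x j
  simp [Function.comp]

/-- All window classes of `WindowClass m D` can be traversed in one cycle. -/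
lemma exists_window_circuit [NeZero n] [Finite K] (D : Set (Necklace n K))
    {e : ZMod n → K} (he : IsPrimitive e) (a : K) (q₀ : WindowClass m D)
    (hq₀ : q₀.1.map (fun v => v ∘ Fin.castSucc) = toNecklace (fun _ _ => a)) :
    ∃ σ : Equiv.Perm (WindowClass m D),
      (∀ q, (σ q).1.map (fun v => v ∘ Fin.castSucc) = q.1.map (fun v => v ∘ Fin.succ)) ∧
      ∀ q, σ.SameCycle q₀ q := by
  let σ₀ : Equiv.Perm (WindowClass m D) := Necklace.shiftColumns.subtypePerm fun q => by
    rw [shiftColumns_isPrimitive_iff, shiftColumns_mem_loops_iff]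
  have hσ₀ : ∀ q : WindowClass m D, (σ₀ q).1.map (fun v => v ∘ Fin.castSucc) =
      q.1.map (fun v => v ∘ Fin.succ) := fun q => shiftColumns_source q.1
  refine exists_eulerian_perm (fun q => q.1.map (fun v => v ∘ Fin.castSucc))
    (fun q => q.1.map (fun v => v ∘ Fin.succ)) σ₀ hσ₀ q₀ ?_
  intro S hS hclosed
  have hpow : ∀ i : ℕ, (σ₀ ^ i) q₀ ∈ S := by
    intro i
    induction i with
    | zero => exact hS
    | succ i ih => rw [pow_succ']; exact hclosed _ ih _ (hσ₀ _)
  -- By finiteness the forward orbit of `q₀` reaches its predecessor, an edge ending at the constant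
  -- vertex.
  obtain ⟨i, hi⟩ : ∃ i : ℕ, (σ₀ ^ i) q₀ = σ₀.symm q₀ :=
    Equiv.Perm.SameCycle.exists_nat_pow_eq
      ((Equiv.Perm.sameCycle_symm_apply_right).2 (Equiv.Perm.SameCycle.refl _ _))
  let U : Set (ZMod n → Fin m → K) :=
    {u | ∃ p ∈ S, p.1.map (fun v => v ∘ Fin.succ) = toNecklace u}
  have hU : ∀ u, u ∈ U := by
    refine mem_of_closed_under_primitive_windows he a U
      ⟨σ₀.symm q₀, hi ▸ hpow i, ?_⟩ ?_
    · rw [← hσ₀, Equiv.apply_symm_apply, hq₀]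
    · rintro w hw ⟨p, hpS, hp⟩
      -- A deleted loop is not needed: its source and target agree.
      by_cases hD : toNecklace w ∈ Necklace.map (fun c (_ : Fin (m + 1)) => c) '' D
      · obtain ⟨q, -, hq⟩ := hD
        obtain ⟨f, rfl⟩ := toNecklace_surjective q
        obtain ⟨r, rfl⟩ := toNecklace_eq_iff.1 hq
        exact ⟨p, hpS, hp⟩
      · refine ⟨⟨toNecklace w, isPrimitive_toNecklace.2 hw, hD⟩, hclosed p hpS _ ?_, rfl⟩
        rw [hp]
        rfl
  intro q
  obtain ⟨u, hu⟩ := toNecklace_surjective (q.1.map (fun v => v ∘ Fin.castSucc))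
  obtain ⟨p, hpS, hp⟩ := hU u
  exact hclosed p hpS q (by rw [← hu, hp])

lemma exists_lift_of_map_eq {L L' : Type*} {g g' : L → L'} (w : ZMod n → L) (q : Necklace n L)
    (h : q.map g = (toNecklace w).map g') :
    ∃ w', toNecklace w' = q ∧ g ∘ w' = g' ∘ w := by
  obtain ⟨f, rfl⟩ := toNecklace_surjective q
  obtain ⟨r, hr⟩ := toNecklace_eq_iff.1 h
  exact ⟨rotate r f, (toNecklace_eq_iff.2 ⟨r, rfl⟩).symm, hr⟩

/-- Consecutive necklaces overlap only up to a shift; rotating each new representative makes the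
overlaps equal as words. -/
lemma exists_lift_walk {L L' : Type*} {g g' : L → L'} (q : ℕ → Necklace n L)
    (h : ∀ t, (q (t + 1)).map g = (q t).map g') (w₀ : ZMod n → L) (h₀ : toNecklace w₀ = q 0) :
    ∃ w : ℕ → ZMod n → L, w 0 = w₀ ∧ (∀ t, toNecklace (w t) = q t) ∧
      ∀ t, g ∘ w (t + 1) = g' ∘ w t := by
  have step : ∀ (t : ℕ) (w : {w : ZMod n → L // toNecklace w = q t}),
      ∃ w' : {w : ZMod n → L // toNecklace w = q (t + 1)}, g ∘ w'.1 = g' ∘ w.1 := by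
    rintro t ⟨w, hw⟩
    obtain ⟨w', hw', h'⟩ := exists_lift_of_map_eq (g := g) (g' := g') w (q (t + 1))
      (by rw [h, hw])
    exact ⟨⟨w', hw'⟩, h'⟩
  choose next hnext using step
  let W : ∀ t : ℕ, {w : ZMod n → L // toNecklace w = q t} :=
    fun t => Nat.rec ⟨w₀, h₀⟩ next t
  exact ⟨fun t => (W t).1, rfl, fun t => (W t).2, fun t => hnext t (W t)⟩

/-- There is a cyclic array with `n` rows whose columns run through all aperiodic classes of
windows of width `m + 1`, except for the loops at the columns in `D`. -/
theorem exists_array_of_loops [NeZero n] [Fintype K] (hm : 0 < m) {D : Set (Necklace n K)}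
    (hD : ∀ q ∈ D, q.IsPrimitive) {e : ZMod n → K} (he : IsPrimitive e) {a : K}
    (hea : ∃ x, e x ≠ a) :
    ∃ (M : ℕ) (B : ZMod n → ZMod M → K), 0 < M ∧
      (M : ℤ) = necklace (Fintype.card K ^ (m + 1)) n - D.ncard ∧
      ∀ x x' y y', (∀ (i : Fin n) (j : Fin (m + 1)),
        B (x + (i : ℕ)) (y + (j : ℕ)) = B (x' + (i : ℕ)) (y' + (j : ℕ))) → x = x' ∧ y = y' := by
  classical
  -- The circuit starts with an edge out of the constant vertex; it is not a loop, as `e` is not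
  -- constantly `a` and `m > 0`.
  let w₀ : ZMod n → Fin (m + 1) → K := fun x j => if j = Fin.last m then e x else a
  have hw₀ : IsPrimitive w₀ := by
    refine IsPrimitive.of_comp (g := fun v => v (Fin.last m)) ?_
    convert he using 1
    funext x
    simp [w₀]
  have hw₀D : toNecklace w₀ ∉ Necklace.map (fun c (_ : Fin (m + 1)) => c) '' D := by
    rintro ⟨q, -, hq⟩
    obtain ⟨f, rfl⟩ := toNecklace_surjective q
    obtain ⟨r, hr⟩ := toNecklace_eq_iff.1 hq
    obtain ⟨x, hx⟩ := hea
    have h1 := congrFun (congrFun hr x) 0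
    have h2 := congrFun (congrFun hr x) (Fin.last m)
    have h3 : (0 : Fin (m + 1)) ≠ Fin.last m := by
      intro h
      have := congrArg Fin.val h
      simp at this
      omega
    simp only [w₀, if_neg h3, if_true] at h1 h2
    exact hx (h2.symm.trans h1)
  have hinit : ((fun v => v ∘ Fin.castSucc) ∘ w₀) = fun _ _ => a := by
    funext x j
    simp [w₀, Fin.castSucc_ne_last]
  let q₀ : WindowClass m D := ⟨toNecklace w₀, isPrimitive_toNecklace.2 hw₀, hw₀D⟩
  obtain ⟨σ, hσ, hcyc⟩ := exists_window_circuit D he a q₀ (by rw [← hinit]; rfl)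
  have : Fintype (WindowClass m D) := Fintype.ofFinite _
  have hon : σ.IsCycleOn ((Finset.univ : Finset (WindowClass m D)) : Set (WindowClass m D)) := by
    rw [Finset.coe_univ]
    exact ⟨Set.bijOn_univ.2 σ.bijective, fun p _ q _ => (hcyc p).symm.trans (hcyc q)⟩
  obtain ⟨W, hW0, hW, hstep⟩ := exists_lift_walk (g := fun v => v ∘ Fin.castSucc)
    (g' := fun v => v ∘ Fin.succ) (fun t => ((σ ^ t) q₀).1)
    (fun t => by rw [pow_succ']; exact hσ _) w₀ rfl
  set M := Nat.card (WindowClass m D) with hMdef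
  have hM' : #(Finset.univ : Finset (WindowClass m D)) = M := by
    rw [hMdef, Nat.card_eq_fintype_card, Finset.card_univ]
  have hM0 : 0 < M := by rw [← hM']; exact Finset.card_pos.2 ⟨q₀, Finset.mem_univ _⟩
  have : NeZero M := ⟨hM0.ne'⟩
  -- After one turn the lift may return rotated, but the overlap at the start is constant, so the
  -- rotation is invisible and the array closes up.
  have hWM : ((fun v => v ∘ Fin.castSucc) ∘ W M) = (fun v => v ∘ Fin.castSucc) ∘ W 0 := by
    have h1 : toNecklace w₀ = toNecklace (W M) := by
      rw [hW, ← hM', hon.pow_card_apply (Finset.mem_univ _)]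
    obtain ⟨r, hr⟩ := toNecklace_eq_iff.1 h1
    rw [← hr, ← rotate_comp, hW0, hinit]
    rfl
  have hcirc : ∀ y : ZMod M, ((fun v => v ∘ Fin.castSucc) ∘ W (y + 1).val) =
      (fun v => v ∘ Fin.succ) ∘ W y.val := by
    intro y
    have h1 : (y + 1).val = (y.val + 1) % M := by
      rw [← ZMod.val_natCast, Nat.cast_add, ZMod.natCast_zmod_val, Nat.cast_one]
    rw [← hstep]
    rcases Nat.lt_or_ge (y.val + 1) M with h | h
    · rw [h1, Nat.mod_eq_of_lt h]
    · have h2 : y.val + 1 = M := le_antisymm (ZMod.val_lt y) h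
      rw [h1, h2, Nat.mod_self, hWM]
  have hwin : ∀ (j : ℕ) (hj : j < m + 1) (y : ZMod M) (x : ZMod n),
      W y.val x ⟨j, hj⟩ = W (y + (j : ℕ)).val x 0 := by
    intro j
    induction j with
    | zero => intro _ y x; simp
    | succ j ih =>
      intro hj y x
      have h1 := congrFun (congrFun (hcirc y) x) ⟨j, by omega⟩
      have h2 := ih (by omega) (y + 1) x
      have h3 : y + ((j + 1 : ℕ) : ZMod M) = y + 1 + (j : ZMod M) := by push_cast; ring
      rw [h3, ← h2]
      exact h1.symm
  refine ⟨M, fun x y => W y.val x 0, hM0, card_windowClass hD, ?_⟩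
  intro x x' y y' h
  have hrot : rotate x (W y.val) = rotate x' (W y'.val) := by
    funext i j
    have := h ⟨i.val, ZMod.val_lt i⟩ j
    simp only [ZMod.natCast_zmod_val, ← hwin j.1 j.2] at this
    rw [rotate_apply, rotate_apply, add_comm i, add_comm i]
    exact this
  have hq : (σ ^ y.val) q₀ = (σ ^ y'.val) q₀ := by
    apply Subtype.ext
    rw [← hW, ← hW]
    exact (toNecklace_eq_iff.2 ⟨x, rfl⟩).trans
      (hrot ▸ (toNecklace_eq_iff.2 ⟨x', rfl⟩).symm)
  rw [hon.pow_apply_eq_pow_apply (Finset.mem_univ _), hM'] at hq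
  have hy : y = y' := by
    have := Nat.ModEq.eq_of_lt_of_lt hq (ZMod.val_lt y) (ZMod.val_lt y')
    exact ZMod.val_injective _ this
  subst hy
  have hprim : IsPrimitive (W y.val) := by
    rw [← isPrimitive_toNecklace, hW]
    exact ((σ ^ y.val) q₀).2.1
  exact ⟨hprim.rotate_injective hrot, rfl⟩

/-- The word with `c` ones (here: letters `b`) followed by letters `a`. -/
def blockWord (n : ℕ) (a b : K) (c : ℕ) : ZMod n → K := fun x => if x.val < c then b else a

/-- The passage from `a` to `b` occurs only between positions `-1` and 0, so no other shift
preserves it. -/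
lemma isPrimitive_blockWord [NeZero n] {a b : K} (hab : a ≠ b) {c : ℕ} (hc : 0 < c) (hcn : c < n) :
    IsPrimitive (blockWord n a b c) := by
  intro r h
  by_contra hr
  have h0 := congrFun h 0
  have h1 := congrFun h (-1)
  have hv0 : r.val ≠ 0 := by rwa [Ne, ZMod.val_eq_zero]
  have hr1 : (-1 + r).val = r.val - 1 := by
    have : -1 + r = ((r.val - 1 : ℕ) : ZMod n) := by
      rw [Nat.cast_sub (by omega), ZMod.natCast_zmod_val]; push_cast; ring
    rw [this, ZMod.val_natCast, Nat.mod_eq_of_lt]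
    have := ZMod.val_lt r
    omega
  have hm1 : (-1 : ZMod n).val = n - 1 := by
    have : (-1 : ZMod n) = ((n - 1 : ℕ) : ZMod n) := by
      rw [Nat.cast_sub (by omega), ZMod.natCast_self]; push_cast; ring
    rw [this, ZMod.val_natCast, Nat.mod_eq_of_lt (by omega)]
  simp only [rotate_apply, blockWord, zero_add, ZMod.val_zero, if_pos hc, hr1, hm1,
    if_neg (show ¬ n - 1 < c by omega)] at h0 h1
  have h2 : r.val < c := by
    by_contra h2
    rw [if_neg h2] at h0
    exact hab h0
  rw [if_pos (by omega)] at h1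
  exact hab h1.symm

/-- The number of letters `b` is invariant under shifts. Hence block words supply enough distinct
loops to delete. -/
lemma toNecklace_blockWord_injOn [NeZero n] {a b : K} (hab : a ≠ b) :
    Set.InjOn (fun c => toNecklace (blockWord n a b c)) (Set.Iic n) := by
  classical
  have hcard : ∀ c ≤ n, #{x : ZMod n | blockWord n a b c x = b} = c := by
    intro c hc
    have h1 : ({x : ZMod n | blockWord n a b c x = b} : Finset _).image ZMod.val =
        Finset.range c := by
      ext t
      simp only [Finset.mem_image, Finset.mem_filter, Finset.mem_univ, true_and,
        Finset.mem_range, blockWord, ite_eq_left_iff, hab, imp_false, not_not]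
      constructor
      · rintro ⟨x, hx, rfl⟩
        exact hx
      · intro ht
        have : (t : ZMod n).val = t := by
          rw [ZMod.val_natCast, Nat.mod_eq_of_lt (by omega)]
        exact ⟨t, by rwa [this], this⟩
    rw [← Finset.card_image_of_injective _ (ZMod.val_injective n), h1, Finset.card_range]
  intro c hc c' hc' h
  obtain ⟨r, hr⟩ := toNecklace_eq_iff.1 h
  rw [← hcard c hc, ← hcard c' hc', ← hr]
  symm
  refine Finset.card_bij (fun x _ => x + r) ?_ (fun x _ y _ h => add_right_cancel h) ?_
  · intro x hx
    rw [Finset.mem_filter] at hx ⊢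
    exact ⟨Finset.mem_univ _, hx.2⟩
  · intro x hx
    rw [Finset.mem_filter] at hx
    refine ⟨x - r, ?_, by simp⟩
    rw [Finset.mem_filter, rotate_apply, sub_add_cancel]
    exact ⟨Finset.mem_univ _, hx.2⟩

/-- There is a cyclic array with `n` rows, whose windows of shape `(n, m + 1)` determine their
position, and whose number of columns is the number of aperiodic classes of windows minus `δ`. -/
theorem exists_array [NeZero n] [Fintype K] (hm : 0 < m) (hn : 2 ≤ n)
    (hK : 2 ≤ Fintype.card K) {δ : ℕ} (hδ : δ < n) :
    ∃ (M : ℕ) (B : ZMod n → ZMod M → K), 0 < M ∧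
      (M : ℤ) = necklace (Fintype.card K ^ (m + 1)) n - δ ∧
      ∀ x x' y y', (∀ (i : Fin n) (j : Fin (m + 1)),
        B (x + (i : ℕ)) (y + (j : ℕ)) = B (x' + (i : ℕ)) (y' + (j : ℕ))) → x = x' ∧ y = y' := by
  obtain ⟨a, b, hab⟩ := Fintype.one_lt_card_iff.1 (show 1 < Fintype.card K by omega)
  have hsub : Set.Icc 1 δ ⊆ Set.Iic n := fun c hc => by
    have := hc.2
    simp only [Set.mem_Iic]
    omega
  have hcard : ((fun c => toNecklace (blockWord n a b c)) '' Set.Icc 1 δ).ncard = δ := by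
    rw [((toNecklace_blockWord_injOn hab).mono hsub).ncard_image,
      ← Finset.coe_Icc, Set.ncard_coe_finset, Nat.card_Icc, Nat.add_sub_cancel]
  have := exists_array_of_loops (m := m) hm
    (D := (fun c => toNecklace (blockWord n a b c)) '' Set.Icc 1 δ) ?_
    (isPrimitive_blockWord hab (c := 1) one_pos (by omega)) (a := a) ⟨0, ?_⟩
  · rwa [hcard] at this
  · rintro _ ⟨c, hc, rfl⟩
    exact isPrimitive_toNecklace.2 (isPrimitive_blockWord hab hc.1 (lt_of_le_of_lt hc.2 hδ))
  · simpa [blockWord] using hab.symm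

end Circuit

/-! ### Side lengths, superposition and asymptotics -/

/-- The divisor `n` contributes `q ^ n`; all others are at most `n / 2`, so their powers sum to less
than the next power of `q`. -/
lemma abs_mul_necklace_sub_lt {q n : ℕ} (hq : 2 ≤ q) (hn : 0 < n) :
    |(n : ℤ) * necklace q n - (q : ℤ) ^ n| < (q : ℤ) ^ (n / 2 + 1) := by
  rw [mul_necklace, ← Nat.cons_self_properDivisors hn.ne', Finset.sum_cons, Nat.div_self hn,
    ArithmeticFunction.moebius_apply_one, one_mul, add_sub_cancel_left]
  have h1 : |∑ d ∈ n.properDivisors, ArithmeticFunction.moebius (n / d) * (q : ℤ) ^ d| ≤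
      ∑ d ∈ n.properDivisors, (q : ℤ) ^ d := by
    refine (Finset.abs_sum_le_sum_abs _ _).trans (Finset.sum_le_sum fun d _ => ?_)
    rw [abs_mul, abs_of_nonneg (show (0 : ℤ) ≤ (q : ℤ) ^ d by positivity)]
    exact mul_le_of_le_one_left (by positivity) ArithmeticFunction.abs_moebius_le_one
  refine h1.trans_lt ?_
  have h2 : ∑ d ∈ n.properDivisors, q ^ d < q ^ (n / 2 + 1) := by
    refine Nat.geomSum_lt hq fun d hd => ?_
    rw [Nat.mem_properDivisors] at hd
    obtain ⟨⟨c, rfl⟩, hlt⟩ := hd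
    have hc : 2 ≤ c := by
      by_contra h
      interval_cases c <;> simp at hlt
    have : d * 2 ≤ d * c := Nat.mul_le_mul_left d hc
    omega
  exact_mod_cast h2

/-- The defect `|n' - 1| * [n' < n - 1]` in the side length of the square maps. -/
lemma squareSide_eq (k n : ℕ) (hn : 2 ≤ n) :
    ∃ δ : ℕ, squareSide k n = n * (necklace (k ^ n) n - δ) ∧ (δ : ℤ) ≤ max 1 ((n : ℤ) - 3) ∧
      IsCoprime (n : ℤ) (necklace (k ^ n) n - δ) := by
  have h0 : 0 ≤ residue k n := Int.emod_nonneg _ (by omega)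
  have h1 : residue k n < n := Int.emod_lt_of_pos _ (by omega)
  have h2 : necklace (k ^ n) n = residue k n + n * (necklace (k ^ n) n / n) :=
    (Int.emod_add_mul_ediv _ _).symm
  -- The reduced count is `s` modulo `n` with `s = ±1`: it is -1 for residues 0 and `n - 1`, and 1
  -- otherwise.
  have hcop : ∀ (s t : ℤ), s * s = 1 → IsCoprime (n : ℤ) (s + n * t) := fun s t hs =>
    ⟨-(s * t), s, by linear_combination hs⟩
  rw [squareSide]
  set r := residue k n
  set c := necklace (k ^ n) n
  by_cases h : r < (n : ℤ) - 1
  · refine ⟨(|r - 1|).toNat, ?_, ?_, ?_⟩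
    · rw [if_pos h, Int.toNat_of_nonneg (abs_nonneg _), mul_one]
    · rw [Int.toNat_of_nonneg (abs_nonneg _), abs_le]
      constructor <;> omega
    · rw [Int.toNat_of_nonneg (abs_nonneg _), h2]
      rcases h0.eq_or_lt with h3 | h3
      · convert hcop (-1) (c / n) (by norm_num) using 1
        rw [← h3]
        norm_num
        ring
      · rw [abs_of_nonneg (by omega)]
        convert hcop 1 (c / n) (by norm_num) using 1
        ring
  · refine ⟨0, ?_, by simp, ?_⟩
    · rw [if_neg h]; simp
    · rw [h2, show r = n - 1 by omega]
      convert hcop (-1) (c / n + 1) (by norm_num) using 1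
      push_cast
      ring

lemma ZMod.eq_of_castHom_eq {n M : ℕ} [NeZero n] [NeZero M] (h : n.Coprime M)
    {x y : ZMod (n * M)}
    (h1 : ZMod.castHom (dvd_mul_right n M) (ZMod n) x =
      ZMod.castHom (dvd_mul_right n M) (ZMod n) y)
    (h2 : ZMod.castHom (dvd_mul_left M n) (ZMod M) x =
      ZMod.castHom (dvd_mul_left M n) (ZMod M) y) : x = y := by
  have : NeZero (n * M) := ⟨Nat.mul_ne_zero (NeZero.ne n) (NeZero.ne M)⟩
  rw [← ZMod.natCast_zmod_val x, ← ZMod.natCast_zmod_val y] at h1 h2 ⊢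
  simp only [map_natCast, ZMod.natCast_eq_natCast_iff] at h1 h2 ⊢
  exact (Nat.modEq_and_modEq_iff_modEq_mul h).1 ⟨h1, h2⟩

/-- A cyclic array with `n` rows and `M` columns, `M` prime to `n`, whose `n × n` windows determine
their position, superposed with its transpose, is a sub-perfect map of side length `n * M`. -/
lemma isSubPerfectMap_superpose {n M : ℕ} {K T : Type*} (hn : 0 < n) (hM : 0 < M)
    (hcop : n.Coprime M) (φ : T ≃ K × K) (B : ZMod n → ZMod M → K)
    (hB : ∀ x x' y y', (∀ (i : Fin n) (j : Fin n),
      B (x + (i : ℕ)) (y + (j : ℕ)) = B (x' + (i : ℕ)) (y' + (j : ℕ))) → x = x' ∧ y = y') :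
    IsSubPerfectMap (fun (x y : ZMod (n * M)) => φ.symm
      (B (ZMod.castHom (dvd_mul_right n M) (ZMod n) x)
          (ZMod.castHom (dvd_mul_left M n) (ZMod M) y),
        B (ZMod.castHom (dvd_mul_right n M) (ZMod n) y)
          (ZMod.castHom (dvd_mul_left M n) (ZMod M) x))) n n := by
  refine ⟨Nat.mul_pos hn hM, Nat.mul_pos hn hM, hn, hn, ?_⟩
  have : NeZero n := ⟨hn.ne'⟩
  have : NeZero M := ⟨hM.ne'⟩
  rintro P ⟨x, y⟩ h ⟨x', y'⟩ h'
  have key := fun i j => (h i j).trans (h' i j).symm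
  simp only [EmbeddingLike.apply_eq_iff_eq, Prod.mk.injEq, map_add, map_natCast] at key
  -- The first letters locate `x` modulo `n` and `y` modulo `M`; the second, with row and column
  -- offsets exchanged, locate `y` modulo `n` and `x` modulo `M`.
  obtain ⟨h1, h2⟩ := hB _ _ _ _ fun i j => (key i j).1
  obtain ⟨h3, h4⟩ := hB _ _ _ _ fun i j => (key j i).2
  rw [ZMod.eq_of_castHom_eq hcop h1 h4, ZMod.eq_of_castHom_eq hcop h3 h2]

lemma exists_square_map {k n : ℕ} (hk : 2 ≤ k) (hn : 2 ≤ n) {T : Type*} [Fintype T]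
    (hT : Fintype.card T = k ^ 2) :
    ∃ (N : ℕ) (A : ZMod N → ZMod N → T), IsSubPerfectMap A n n ∧ (N : ℤ) = squareSide k n := by
  have : NeZero n := ⟨by omega⟩
  obtain ⟨δ, hside, hδ, hcop⟩ := squareSide_eq k n hn
  have hδn : δ < n := by omega
  obtain ⟨m, rfl⟩ : ∃ m, n = m + 1 := ⟨n - 1, by omega⟩
  obtain ⟨M, B, hM, hMc, hB⟩ := exists_array (K := Fin k) (n := m + 1) (m := m) (by omega) hn
    (by rwa [Fintype.card_fin]) hδn
  rw [Fintype.card_fin] at hMc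
  have φ : T ≃ Fin k × Fin k := Fintype.equivOfCardEq (by simp [hT, sq])
  refine ⟨(m + 1) * M, _, isSubPerfectMap_superpose (by omega) hM ?_ φ B hB, ?_⟩
  · rw [← hMc] at hcop
    exact Nat.isCoprime_iff_coprime.1 hcop
  · rw [hside, ← hMc]
    push_cast
    ring

lemma abs_squareSide_sub_le {k n : ℕ} (hk : 2 ≤ k) (hn : 3 ≤ n) :
    |squareSide k n - (k : ℤ) ^ (n ^ 2)| ≤ 2 * (k : ℤ) ^ (n ^ 2 - n) := by
  obtain ⟨δ, hside, hδ, -⟩ := squareSide_eq k n (by omega)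
  have hq : 2 ≤ k ^ n := hk.trans (Nat.le_self_pow (by omega) k)
  have h1 := abs_mul_necklace_sub_lt hq (show 0 < n by omega)
  have hk0 : 0 < k := by omega
  have h2 : (k ^ n) ^ (n / 2 + 1) ≤ k ^ (n ^ 2 - n) := by
    rw [← pow_mul]
    apply Nat.pow_le_pow_right hk0
    -- This is where `n = 2` fails.
    have : n / 2 + 1 ≤ n - 1 := by omega
    calc n * (n / 2 + 1) ≤ n * (n - 1) := Nat.mul_le_mul_left n this
      _ = n ^ 2 - n := by rw [Nat.mul_sub, sq, mul_one]
  have h3 : n * n ≤ k ^ (n ^ 2 - n) := by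
    have h4 : n ≤ k ^ n := (Nat.lt_pow_self (by omega)).le
    calc n * n ≤ k ^ n * k ^ n := Nat.mul_le_mul h4 h4
      _ = k ^ (n + n) := (pow_add _ _ _).symm
      _ ≤ k ^ (n ^ 2 - n) := by
        apply Nat.pow_le_pow_right hk0
        have : 3 * n ≤ n ^ 2 := by rw [sq]; exact Nat.mul_le_mul_right n hn
        omega
  have h2' : (((k ^ n : ℕ) : ℤ)) ^ (n / 2 + 1) ≤ (k : ℤ) ^ (n ^ 2 - n) := by exact_mod_cast h2
  have h3' : (n : ℤ) * n ≤ (k : ℤ) ^ (n ^ 2 - n) := by exact_mod_cast h3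
  have h5 : ((k ^ n : ℕ) : ℤ) ^ n = (k : ℤ) ^ (n ^ 2) := by push_cast; rw [← pow_mul, sq]
  have h6 : (n : ℤ) * δ ≤ n * n := by
    apply mul_le_mul_of_nonneg_left _ (by positivity)
    omega
  have h7 : (0 : ℤ) ≤ n * δ := by positivity
  rw [h5, abs_lt] at h1
  rw [hside, mul_sub, abs_le]
  constructor <;> linarith [h1.1, h1.2]

lemma tendsto_squareSide_div {k : ℕ} (hk : 2 ≤ k) :
    Filter.Tendsto (fun n : ℕ => (squareSide k n : ℝ) / (k : ℝ) ^ (n ^ 2)) Filter.atTop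
      (nhds 1) := by
  have hk0 : (0 : ℝ) < k := by exact_mod_cast (show 0 < k by omega)
  -- The relative error is at most `2 / k ^ n`, and `k ≥ 2`.
  have hlim : Filter.Tendsto (fun n : ℕ => 2 * (1 / 2 : ℝ) ^ n) Filter.atTop (nhds 0) := by
    simpa using (tendsto_pow_atTop_nhds_zero_of_lt_one (r := (1 / 2 : ℝ)) (by norm_num)
      (by norm_num)).const_mul 2
  rw [tendsto_iff_dist_tendsto_zero]
  refine squeeze_zero' (Filter.Eventually.of_forall fun n => dist_nonneg) ?_ hlim
  filter_upwards [Filter.eventually_ge_atTop 3] with n hn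
  have h1 : |(squareSide k n : ℝ) - (k : ℝ) ^ (n ^ 2)| ≤ 2 * (k : ℝ) ^ (n ^ 2 - n) := by
    exact_mod_cast abs_squareSide_sub_le hk hn
  have h2 : (k : ℝ) ^ (n ^ 2) = (k : ℝ) ^ (n ^ 2 - n) * (k : ℝ) ^ n := by
    rw [← pow_add, Nat.sub_add_cancel (Nat.le_self_pow two_ne_zero n)]
  have h3 : (0 : ℝ) < (k : ℝ) ^ (n ^ 2) := by positivity
  have h4 : (2 : ℝ) ^ n ≤ (k : ℝ) ^ n :=
    pow_le_pow_left₀ (by norm_num) (by exact_mod_cast hk) n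
  rw [Real.dist_eq, div_sub_one h3.ne', abs_div, abs_of_pos h3, div_le_iff₀ h3]
  refine h1.trans ?_
  rw [h2, mul_assoc]
  refine mul_le_mul_of_nonneg_left ?_ (by norm_num)
  calc (k : ℝ) ^ (n ^ 2 - n) = (k : ℝ) ^ (n ^ 2 - n) * ((1 / 2) ^ n * 2 ^ n) := by
        rw [← mul_pow]; norm_num
    _ ≤ (k : ℝ) ^ (n ^ 2 - n) * ((1 / 2) ^ n * (k : ℝ) ^ n) := by gcongr
    _ = _ := by ring

theorem mainTheorem4 (k : ℕ) (hk : 2 ≤ k) (T : Type*) [Fintype T]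
    (hT : Fintype.card T = k ^ 2) :
    (∀ n : ℕ, 2 ≤ n →
      ∃ (N : ℕ) (A : ZMod N → ZMod N → T),
        IsSubPerfectMap A n n ∧
        (N : ℤ) = squareSide k n ∧
        (N : ℤ) ≥ n * (necklace (k ^ n) n - max 1 ((n : ℤ) - 3)) ∧
        (n : ℤ) * (necklace (k ^ n) n - max 1 ((n : ℤ) - 3)) >
          (k : ℤ) ^ (n ^ 2) - (k : ℤ) ^ ((n / 2 + 1) * n)
            - max (n : ℤ) ((n : ℤ) ^ 2 - 3 * n)) ∧
    IsAlmostPerfectFamily (squareMaps k T) := by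
  refine ⟨fun n hn => ?_, ?_, ?_, ?_⟩
  · obtain ⟨N, A, hA, hN⟩ := exists_square_map hk hn hT
    refine ⟨N, A, hA, hN, ?_, ?_⟩
    · obtain ⟨δ, hside, hδ, -⟩ := squareSide_eq k n hn
      rw [hN, hside]
      exact mul_le_mul_of_nonneg_left (by linarith) (by positivity)
    · have h1 := abs_mul_necklace_sub_lt (hk.trans (Nat.le_self_pow (by omega : n ≠ 0) k))
        (show 0 < n by omega)
      push_cast at h1
      rw [← pow_mul, ← pow_mul, mul_comm n (n / 2 + 1), ← sq, abs_lt] at h1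
      rw [mul_sub, mul_max_of_nonneg _ _ (by positivity : (0 : ℤ) ≤ n), mul_one,
        show (n : ℤ) * (n - 3) = (n : ℤ) ^ 2 - 3 * n by ring]
      linarith [h1.1]
  · rw [hT]
    nlinarith
  · intro m' n' _ _
    obtain ⟨N, A, hA, hN⟩ := exists_square_map hk (show 2 ≤ m' + n' + 1 by omega) hT
    exact ⟨⟨N, N, _, _, A, hA⟩, ⟨by simp only; omega, rfl, hN, hN⟩, by simp only; omega,
      by simp only; omega⟩
  · intro A hA hinc
    have hmono : StrictMono fun i => (A i).n := fun i j hij => (hinc i j hij).2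
    have h := (tendsto_squareSide_div hk).comp hmono.tendsto_atTop
    -- Both sides of the map are `squareSide`, and the alphabet has `k ^ 2` letters, so the density
    -- is the square of the previous ratio.
    have h2 := h.mul h
    rw [mul_one] at h2
    refine h2.congr fun i => ?_
    obtain ⟨-, hm, hM, hN⟩ := hA i
    have hM' : ((A i).M : ℝ) = squareSide k (A i).n := by exact_mod_cast hM
    have hN' : ((A i).N : ℝ) = squareSide k (A i).n := by exact_mod_cast hN
    simp only [Function.comp_apply]
    rw [hM', hN', hm, hT, div_mul_div_comm, ← sq ((k : ℝ) ^ _), ← pow_mul, Nat.cast_pow, ← pow_mul,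
      ← sq (A i).n, mul_comm 2]
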